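/- Let $0\le d<n$ and let $L\subset\mathbb{P}^n$ be a $d$-dimensional linear subspace of complex projective space that is not contained in any coordinate hyperplane. Let $T\subset\mathbb{P}^n$ be the set of points all of whose homogeneous coordinates are nonzero. Let $L^{-1}$ be the reciprocal linear space of $L$, that is, the Zariski closure of $\{(x_0^{-1}:\cdots:x_n^{-1}) : x\in L\cap T\}$, and let $L^2=\{(x_0^2:\cdots:x_n^2) : x\in L\}$. Identify $(\mathbb{P}^n)^\vee$ with $\mathbb{P}^n$ by letting $z$ stand for the hyperplane $H_z=\{x : \sum_i z_ix_i=0\}$, and let $L^\perp=\{z : \sum_i z_i x_i=0 \text{ for all } x\in L\}$. The matroid discriminant variety $\nabla(L^{-1})\subset(\mathbb{P}^n)^\vee$ of $L$ is the projective dual variety of $L^{-1}$, i.e. the Zariski closure of the set of all $z$ such that $H_z$ contains the projective tangent space of $L^{-1}$ at some regular point of $L^{-1}$. For $X,Y\subset\mathbb{P}^n$, the Hadamard product $X\star Y$ is the Zariski closure of $\{(x_0y_0:\cdots:x_ny_n) : x\in X,\ y\in Y,\ x_iy_i \text{ not all zero}\}$. Then $$\nabla(L^{-1}) = L^2\star L^\perp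 .$$ Consequently, let $A\in\mathbb{C}^{(d+1)\times(n+1)}$ be any matrix whose projectivized row span is $L$, with columns $a_0,\dots,a_n$, and let $B\in\mathbb{C}^{(n+1)\times(n-d)}$ be any matrix whose columns form a basis of $\ker A$, with rows $b_0,\dots,b_n$. Then $\nabla(L^{-1})$ is the Zariski closure of the image of the rational map $$\mathbb{P}^d\times\mathbb{P}^{n-d-1}\dashrightarrow(\mathbb{P}^n)^\vee,\qquad (t,u)\mapsto\big((t\cdot a_0)^2(b_0\cdot u):\cdots:(t\cdot a_n)^2(b_n\cdot u)\big).$$ -/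

import Mathlib

open scoped LinearAlgebra.Projectivization

noncomputable section

namespace MatroidDiscriminant

/-- Complex projective `n`-space, with homogeneous coordinates `x_0, ..., x_n`. The dual projective
space is identified with it by letting `(z_0 : ... : z_n)` stand for the hyperplane
`z_0 x_0 + ... + z_n x_n = 0`. -/
abbrev PSpace (n : ℕ) : Type := ℙ ℂ (Fin (n + 1) → ℂ)

/-- The homogeneous polynomials (of any degree) that vanish at all points of `X`. The vanishing of a
homogeneous polynomial at a point does not depend on the representative, see `eval_rep_eq_zero_iff`. -/
def homogeneousVanishing {n : ℕ} (X : Set (PSpace n)) : Set (MvPolynomial (Fin (n + 1)) ℂ) :=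
  {f | (∃ k : ℕ, f.IsHomogeneous k) ∧ ∀ p ∈ X, MvPolynomial.eval p.rep f = 0}

theorem eval_smul_of_isHomogeneous {n k : ℕ} {f : MvPolynomial (Fin (n + 1)) ℂ}
    (hf : f.IsHomogeneous k) (c : ℂ) (v : Fin (n + 1) → ℂ) :
    MvPolynomial.eval (c • v) f = c ^ k * MvPolynomial.eval v f := by
  simp only [MvPolynomial.eval_eq, Finset.mul_sum]
  refine Finset.sum_congr rfl fun m hm => ?_
  have h : m.degree = k := by
    rw [Finsupp.degree_eq_weight_one]
    exact hf (MvPolynomial.mem_support_iff.mp hm)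
  simp only [Pi.smul_apply, smul_eq_mul, mul_pow, Finset.prod_mul_distrib]
  rw [Finset.prod_pow_eq_pow_sum, ← h, Finsupp.degree_apply]
  ring

theorem eval_rep_eq_zero_iff {n k : ℕ} {f : MvPolynomial (Fin (n + 1)) ℂ}
    (hf : f.IsHomogeneous k) (v : Fin (n + 1) → ℂ) (hv : v ≠ 0) :
    MvPolynomial.eval (Projectivization.mk ℂ v hv).rep f = 0 ↔ MvPolynomial.eval v f = 0 := by
  obtain ⟨a, ha⟩ := Projectivization.exists_smul_eq_mk_rep ℂ v hv
  rw [← ha, Units.smul_def, eval_smul_of_isHomogeneous hf]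
  simp

/-- The Zariski closure of a set of points of projective space. -/
def zariskiClosure {n : ℕ} (S : Set (PSpace n)) : Set (PSpace n) :=
  {p | ∀ f ∈ homogeneousVanishing S, MvPolynomial.eval p.rep f = 0}

/-- The homogeneous vanishing ideal `I(X)`. -/
def vanishingIdeal {n : ℕ} (X : Set (PSpace n)) : Ideal (MvPolynomial (Fin (n + 1)) ℂ) :=
  Ideal.span (homogeneousVanishing X)

/-- The homogeneous coordinate ring `ℂ[x_0, ..., x_n] / I(X)`. For an irreducible closed `X` its
transcendence degree over `ℂ` is `dim X + 1`. -/
abbrev CoordinateRing {n : ℕ} (X : Set (PSpace n)) : Type :=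
  MvPolynomial (Fin (n + 1)) ℂ ⧸ vanishingIdeal X

/-- The linear space whose projectivization is the projective tangent space of `X` at `x`: the kernel
at `x` of the Jacobian matrix of the homogeneous equations of `X`. -/
def tangentSpace {n : ℕ} (X : Set (PSpace n)) (x : PSpace n) : Submodule ℂ (Fin (n + 1) → ℂ) where
  carrier := {y | ∀ f ∈ homogeneousVanishing X,
    ∑ j, MvPolynomial.eval x.rep (MvPolynomial.pderiv j f) * y j = 0}
  zero_mem' := by intro f _; simp
  add_mem' := by
    intro a b ha hb f hf
    simp only [Pi.add_apply, mul_add, Finset.sum_add_distrib, ha f hf, hb f hf, add_zero]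
  smul_mem' := by
    intro c a ha f hf
    simp only [Pi.smul_apply, smul_eq_mul, mul_left_comm _ c, ← Finset.mul_sum, ha f hf, mul_zero]

/-- The regular points of an irreducible closed subvariety `X` (Jacobian criterion): the points at
which the projective tangent space has dimension `dim X`. Both sides below are that number plus
one. -/
def regularPoints {n : ℕ} (X : Set (PSpace n)) : Set (PSpace n) :=
  {x | x ∈ X ∧ (Module.finrank ℂ (tangentSpace X x) : Cardinal) = Algebra.trdeg ℂ (CoordinateRing X)}

/-- The conormal bundle of the regular locus of `X`: the pairs `(x, z)` such that `x` is a regular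
point of `X` and the hyperplane `H_z` contains the projective tangent space of `X` at `x`. -/
def conormal {n : ℕ} (X : Set (PSpace n)) : Set (PSpace n × PSpace n) :=
  {p | p.1 ∈ regularPoints X ∧ ∀ y ∈ tangentSpace X p.1, ∑ i, p.2.rep i * y i = 0}

/-- The projective dual variety `∇(X)` of an irreducible closed subvariety `X`. -/
def dualVariety {n : ℕ} (X : Set (PSpace n)) : Set (PSpace n) :=
  zariskiClosure (Prod.snd '' conormal X)

/-- The dense torus `T`: all homogeneous coordinates are nonzero. -/
def torus (n : ℕ) : Set (PSpace n) := {p | ∀ i, p.rep i ≠ 0}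

theorem zpow_coords_ne_zero {n : ℕ} (k : ℤ) {v : Fin (n + 1) → ℂ} (hv : v ≠ 0) :
    (fun i => v i ^ k) ≠ 0 := by
  obtain ⟨i, hi⟩ := Function.ne_iff.mp hv
  exact Function.ne_iff.mpr ⟨i, zpow_ne_zero k hi⟩

/-- The coordinatewise power map `φ_k (x_0 : ... : x_n) = (x_0 ^ k : ... : x_n ^ k)`. For `k < 0`
only its values on the torus are used. -/
def powerMap {n : ℕ} (k : ℤ) (p : PSpace n) : PSpace n :=
  Projectivization.mk ℂ (fun i => p.rep i ^ k) (zpow_coords_ne_zero k p.rep_nonzero)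

theorem powerMap_mk {n : ℕ} (k : ℤ) (v : Fin (n + 1) → ℂ) (hv : v ≠ 0) :
    powerMap k (Projectivization.mk ℂ v hv) =
      Projectivization.mk ℂ (fun i => v i ^ k) (zpow_coords_ne_zero k hv) := by
  obtain ⟨a, ha⟩ := Projectivization.exists_smul_eq_mk_rep ℂ v hv
  refine (Projectivization.mk_eq_mk_iff' ℂ _ _ _ _).mpr ⟨(a : ℂ) ^ k, ?_⟩
  rw [← ha]
  funext i
  simp [Units.smul_def, mul_zpow]

/-- The coordinatewise power `X ^ k` of a projective variety: `φ_k (X)` if `0 ≤ k`, and the closure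
of `φ_k (X ∩ T)` if `k < 0`. -/
def varietyPower {n : ℕ} (X : Set (PSpace n)) (k : ℤ) : Set (PSpace n) :=
  if 0 ≤ k then powerMap k '' X else zariskiClosure (powerMap k '' (X ∩ torus n))

/-- The Hadamard product `X ⋆ Y`. -/
def hadamardProduct {n : ℕ} (X Y : Set (PSpace n)) : Set (PSpace n) :=
  zariskiClosure {z | ∃ x ∈ X, ∃ y ∈ Y, ∃ h : (fun i => x.rep i * y.rep i) ≠ 0,
    z = Projectivization.mk ℂ (fun i => x.rep i * y.rep i) h}

/-- The linear subspace of projective space given by a linear subspace of `ℂ^(n+1)`. -/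
def linearSpace {n : ℕ} (W : Submodule ℂ (Fin (n + 1) → ℂ)) : Set (PSpace n) :=
  {p | p.rep ∈ W}

/-- The orthogonal complement for the bilinear pairing `∑ x_i y_i` (no complex conjugation). -/
def perp {n : ℕ} (W : Submodule ℂ (Fin (n + 1) → ℂ)) : Submodule ℂ (Fin (n + 1) → ℂ) where
  carrier := {y | ∀ x ∈ W, ∑ i, x i * y i = 0}
  zero_mem' := by intro x _; simp
  add_mem' := by
    intro a b ha hb x hx
    simp only [Pi.add_apply, mul_add, Finset.sum_add_distrib, ha x hx, hb x hx, add_zero]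
  smul_mem' := by
    intro c a ha x hx
    simp only [Pi.smul_apply, smul_eq_mul, mul_left_comm _ c, ← Finset.mul_sum, ha x hx, mul_zero]

/-- The matroid discriminant variety `∇(L⁻¹)` of a linear space `L`, where `L⁻¹` is the reciprocal
linear space. -/
def matroidDiscriminantVariety {n : ℕ} (L : Set (PSpace n)) : Set (PSpace n) :=
  dualVariety (varietyPower L (-1))

/-- The image of the rational map `h_L : ℙ^d × ℙ^(n-d-1) ⇢ ℙ^n`,
`(t, u) ↦ ((t·a_0)² (b_0·u) : ... : (t·a_n)² (b_n·u))`, where the `a_i` are the columns of `A` and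
the `b_i` are the rows of `B`. -/
def uniformizationImage {n d m : ℕ} (A : Matrix (Fin (d + 1)) (Fin (n + 1)) ℂ)
    (B : Matrix (Fin (n + 1)) (Fin m) ℂ) : Set (PSpace n) :=
  {z | ∃ (t : PSpace d) (u : ℙ ℂ (Fin m → ℂ))
    (h : (fun i => (∑ j, t.rep j * A j i) ^ 2 * ∑ k, B i k * u.rep k) ≠ 0),
    z = Projectivization.mk ℂ (fun i => (∑ j, t.rep j * A j i) ^ 2 * ∑ k, B i k * u.rep k) h}

end MatroidDiscriminant

end

noncomputable section

namespace MatroidDiscriminant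

variable {n : ℕ}

/-! Let `L` be the projectivization of `W`. At a torus point `v` of `L⁻¹`, so `v⁻¹ ∈ W`, the tangent
space is `v² W` (`mem_tangentSpace_reciprocal`): curves in the cone give one inclusion, the
equations `∑ yᵢ / xᵢ = 0` with `y ∈ W^⊥` the other. Hence the conormal vectors at `v` are `v⁻² W^⊥`,
that is, the products `x² y` with `x = v⁻¹` and `y ∈ W^⊥`.

Three points remain. Torus points must be regular, so the coordinate ring must have transcendence
degree `d + 1` (`trdeg_coordinateRing_reciprocal`). Points `x ∈ W` off the torus are reached by
density (`eq_zero_of_eval_eq_zero_on_torus`). Conormal vectors at regular points off the torus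
extend to polynomial fields that are conormal along the torus part (`exists_polynomial_conormal`),
so they satisfy the same equations.

Both closures are compared through the homogeneous polynomials vanishing on the two sets. The
Hadamard product and the uniformization are further descriptions of the set of all `x² y`. -/

theorem perp_perp (W : Submodule ℂ (Fin (n + 1) → ℂ)) : perp (perp W) = W := by
  refine le_antisymm (fun y hy => ?_) fun y hy x hx => ?_
  · by_contra hyW
    -- A functional that kills `W` but not `y`; its coordinate vector lies in `perp W` and
    -- contradicts `hy`.
    obtain ⟨f, hfy, hfW⟩ := Submodule.exists_dual_map_eq_bot_of_notMem hyW inferInstance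
    have hf : ∀ x, f x = ∑ i, x i * f (Pi.single i 1) := fun x => by
      conv_lhs => rw [pi_eq_sum_univ' x]
      simp [map_sum]
    have hz : (fun i => f (Pi.single i 1)) ∈ perp W := fun x hx => by
      rw [← hf]
      have : f x ∈ W.map f := Submodule.mem_map_of_mem hx
      rwa [hfW, Submodule.mem_bot] at this
    have := hy _ hz
    apply hfy
    rw [hf, ← this]
    exact Finset.sum_congr rfl fun i _ => mul_comm _ _
  · rw [← hx y hy]
    exact Finset.sum_congr rfl fun i _ => mul_comm _ _

theorem subset_zariskiClosure (S : Set (PSpace n)) : S ⊆ zariskiClosure S :=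
  fun p hp _ hf => hf.2 p hp

theorem homogeneousVanishing_zariskiClosure (S : Set (PSpace n)) :
    homogeneousVanishing (zariskiClosure S) = homogeneousVanishing S := by
  ext f
  exact ⟨fun h => ⟨h.1, fun p hp => h.2 p (subset_zariskiClosure S hp)⟩,
    fun h => ⟨h.1, fun p hp => hp f h⟩⟩

theorem zariskiClosure_eq_of_homogeneousVanishing_eq {S S' : Set (PSpace n)}
    (h : homogeneousVanishing S = homogeneousVanishing S') :
    zariskiClosure S = zariskiClosure S' := by
  simp only [zariskiClosure, h]

/-! ### The cone over the reciprocal linear space and its equations -/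

/-- The affine cone over the part in the torus of the reciprocal linear space. -/
def reciprocalCone (W : Submodule ℂ (Fin (n + 1) → ℂ)) : Set (Fin (n + 1) → ℂ) :=
  {v | (∀ i, v i ≠ 0) ∧ v⁻¹ ∈ W}

theorem smul_mem_reciprocalCone {W : Submodule ℂ (Fin (n + 1) → ℂ)} {v : Fin (n + 1) → ℂ}
    (hv : v ∈ reciprocalCone W) {c : ℂ} (hc : c ≠ 0) : c • v ∈ reciprocalCone W := by
  refine ⟨fun i => mul_ne_zero hc (hv.1 i), ?_⟩
  have : (c • v)⁻¹ = c⁻¹ • v⁻¹ := by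
    funext i
    simp [mul_comm]
  rw [this]
  exact W.smul_mem _ hv.2

theorem inv_mem_reciprocalCone {W : Submodule ℂ (Fin (n + 1) → ℂ)} {w : Fin (n + 1) → ℂ}
    (hw : w ∈ W) (h : ∀ i, w i ≠ 0) : w⁻¹ ∈ reciprocalCone W :=
  ⟨fun i => inv_ne_zero (h i), by rwa [inv_inv]⟩

theorem ne_zero_of_forall_ne_zero {v : Fin (n + 1) → ℂ} (hv : ∀ i, v i ≠ 0) : v ≠ 0 :=
  fun h => hv 0 (by rw [h]; rfl)

theorem mk_mem_linearSpace {W : Submodule ℂ (Fin (n + 1) → ℂ)} {v : Fin (n + 1) → ℂ}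
    (hv : v ≠ 0) (h : v ∈ W) : Projectivization.mk ℂ v hv ∈ linearSpace W := by
  obtain ⟨a, ha⟩ := Projectivization.exists_smul_eq_mk_rep ℂ v hv
  rw [linearSpace, Set.mem_ofPred_eq, ← ha]
  exact W.smul_mem _ h

theorem mk_mem_torus {v : Fin (n + 1) → ℂ} (hv : v ≠ 0) (h : ∀ i, v i ≠ 0) :
    Projectivization.mk ℂ v hv ∈ torus n := by
  obtain ⟨a, ha⟩ := Projectivization.exists_smul_eq_mk_rep ℂ v hv
  intro i
  rw [← ha]
  exact mul_ne_zero a.ne_zero (h i)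

theorem mem_homogeneousVanishing_reciprocal {W : Submodule ℂ (Fin (n + 1) → ℂ)}
    {f : MvPolynomial (Fin (n + 1)) ℂ} :
    f ∈ homogeneousVanishing (varietyPower (linearSpace W) (-1)) ↔
      (∃ k : ℕ, f.IsHomogeneous k) ∧ ∀ v ∈ reciprocalCone W, MvPolynomial.eval v f = 0 := by
  rw [varietyPower, if_neg (by norm_num), homogeneousVanishing_zariskiClosure]
  refine and_congr_right fun ⟨k, hf⟩ => ⟨fun h v hv => ?_, ?_⟩
  · have hv0 := ne_zero_of_forall_ne_zero hv.1
    have hi0 : ∀ i, v⁻¹ i ≠ 0 := fun i => inv_ne_zero (hv.1 i)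
    have hi := ne_zero_of_forall_ne_zero hi0
    have := h _ ⟨_, ⟨mk_mem_linearSpace hi hv.2, mk_mem_torus hi hi0⟩, rfl⟩
    rw [powerMap_mk, eval_rep_eq_zero_iff hf] at this
    simpa using this
  · rintro h _ ⟨p, ⟨hp, hpT⟩, rfl⟩
    rw [powerMap, eval_rep_eq_zero_iff hf]
    have := h _ (inv_mem_reciprocalCone hp hpT)
    convert this using 2
    simp
    rfl

/-- A point of the reciprocal cone gives a point of the reciprocal linear space. -/
theorem mk_mem_reciprocal {W : Submodule ℂ (Fin (n + 1) → ℂ)} {v : Fin (n + 1) → ℂ}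
    (hv : v ∈ reciprocalCone W) (hv0 : v ≠ 0) :
    Projectivization.mk ℂ v hv0 ∈ varietyPower (linearSpace W) (-1) := by
  rw [varietyPower, if_neg (by norm_num)]
  apply subset_zariskiClosure
  have hi0 : ∀ i, v⁻¹ i ≠ 0 := fun i => inv_ne_zero (hv.1 i)
  have hi := ne_zero_of_forall_ne_zero hi0
  refine ⟨_, ⟨mk_mem_linearSpace hi hv.2, mk_mem_torus hi hi0⟩, ?_⟩
  rw [powerMap_mk]
  congr 1
  simp

/-- The homogeneous components of a polynomial that vanishes on a punctured line through the origin
vanish there as well. -/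
theorem eval_homogeneousComponent_eq_zero {f : MvPolynomial (Fin (n + 1)) ℂ}
    {v : Fin (n + 1) → ℂ} (h : ∀ c : ℂ, c ≠ 0 → MvPolynomial.eval (c • v) f = 0) (k : ℕ) :
    MvPolynomial.eval v (MvPolynomial.homogeneousComponent k f) = 0 := by
  by_cases hk : f.totalDegree < k
  · rw [MvPolynomial.homogeneousComponent_eq_zero _ _ hk, map_zero]
  let a : ℕ → ℂ := fun i => MvPolynomial.eval v (MvPolynomial.homogeneousComponent i f)
  -- `g` is `c ↦ f(c v)` as a polynomial in `c`; it has infinitely many roots, so each coefficient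
  -- vanishes.
  let g : Polynomial ℂ := ∑ i ∈ Finset.range (f.totalDegree + 1), Polynomial.monomial i (a i)
  have hg : g = 0 := by
    refine Polynomial.eq_zero_of_infinite_isRoot g ((Set.finite_singleton (0 : ℂ)).infinite_compl.mono
      fun c hc => ?_)
    have := h c hc
    rw [← MvPolynomial.sum_homogeneousComponent f, map_sum] at this
    simp only [Set.mem_ofPred_eq, Polynomial.IsRoot, g, Polynomial.eval_finsetSum,
      Polynomial.eval_monomial]
    rw [← this]
    refine Finset.sum_congr rfl fun i _ => ?_
    rw [eval_smul_of_isHomogeneous (MvPolynomial.homogeneousComponent_isHomogeneous i f), mul_comm]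
  have : g.coeff k = a k := by
    simp only [g, Polynomial.finsetSum_coeff, Polynomial.coeff_monomial]
    rw [Finset.sum_ite_eq', if_pos (Finset.mem_range.mpr (by omega))]
  rw [hg, Polynomial.coeff_zero] at this
  exact this.symm

theorem homogeneousComponent_mem_homogeneousVanishing {W : Submodule ℂ (Fin (n + 1) → ℂ)}
    {f : MvPolynomial (Fin (n + 1)) ℂ} (hf : ∀ v ∈ reciprocalCone W, MvPolynomial.eval v f = 0)
    (k : ℕ) : MvPolynomial.homogeneousComponent k f ∈
      homogeneousVanishing (varietyPower (linearSpace W) (-1)) :=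
  mem_homogeneousVanishing_reciprocal.mpr
    ⟨⟨k, MvPolynomial.homogeneousComponent_isHomogeneous k f⟩, fun _ hv =>
      eval_homogeneousComponent_eq_zero (fun _ hc => hf _ (smul_mem_reciprocalCone hv hc)) k⟩

/-- The closure is defined by homogeneous polynomials only. The cone is stable under scaling, so
inhomogeneous ones, such as compositions with a polynomial vector field, pass to the closure too. -/
theorem eval_rep_eq_zero_of_mem_reciprocal {W : Submodule ℂ (Fin (n + 1) → ℂ)}
    {f : MvPolynomial (Fin (n + 1)) ℂ} (hf : ∀ v ∈ reciprocalCone W, MvPolynomial.eval v f = 0)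
    {p : PSpace n} (hp : p ∈ varietyPower (linearSpace W) (-1)) :
    MvPolynomial.eval p.rep f = 0 := by
  rw [← MvPolynomial.sum_homogeneousComponent f, map_sum]
  exact Finset.sum_eq_zero fun k _ => (homogeneousComponent_mem_homogeneousVanishing hf k).2 p hp

/-! ### Tangent spaces at torus points -/

theorem hasDerivAt_eval (f : MvPolynomial (Fin (n + 1)) ℂ) {γ : ℂ → Fin (n + 1) → ℂ}
    {γ' : Fin (n + 1) → ℂ} {s : ℂ} (h : ∀ i, HasDerivAt (fun t => γ t i) (γ' i) s) :
    HasDerivAt (fun t => MvPolynomial.eval (γ t) f)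
      (∑ j, MvPolynomial.eval (γ s) (MvPolynomial.pderiv j f) * γ' j) s := by
  induction f using MvPolynomial.induction_on with
  | C a => simpa using hasDerivAt_const s a
  | add p q hp hq =>
    simp only [map_add, add_mul, Finset.sum_add_distrib]
    exact hp.fun_add hq
  | mul_X p i hp =>
    simp only [map_mul, MvPolynomial.eval_X]
    refine (hp.fun_mul (h i)).congr_deriv ?_
    simp only [Derivation.leibniz, MvPolynomial.pderiv_X, smul_eq_mul, map_add, map_mul,
      MvPolynomial.eval_X, add_mul, Finset.sum_add_distrib, Pi.single_apply]
    rw [add_comm]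
    congr 1
    · simp [apply_ite]
    · rw [Finset.sum_mul]
      exact Finset.sum_congr rfl fun j _ => by ring

/-- The curve `t ↦ (v⁻¹ - t w)⁻¹` stays in the cone for small `t` and has velocity `v² w` at `t =
0`. Differentiate `f` along it. -/
theorem sum_eval_pderiv_mul_sq_eq_zero {W : Submodule ℂ (Fin (n + 1) → ℂ)}
    {f : MvPolynomial (Fin (n + 1)) ℂ} (hf : ∀ v ∈ reciprocalCone W, MvPolynomial.eval v f = 0)
    {v w : Fin (n + 1) → ℂ} (hv : v ∈ reciprocalCone W) (hw : w ∈ W) :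
    ∑ j, MvPolynomial.eval v (MvPolynomial.pderiv j f) * (v j ^ 2 * w j) = 0 := by
  have hγ : ∀ i, HasDerivAt (fun t : ℂ => ((v i)⁻¹ - t * w i)⁻¹) (v i ^ 2 * w i) 0 := fun i => by
    have h1 : HasDerivAt (fun t : ℂ => (v i)⁻¹ - t * w i) (-(1 * w i)) 0 :=
      ((hasDerivAt_id (0 : ℂ)).mul_const (w i)).const_sub _
    refine (h1.fun_inv (by simpa using hv.1 i)).congr_deriv ?_
    simp [mul_comm]
  have hd := hasDerivAt_eval f (γ := fun t i => ((v i)⁻¹ - t * w i)⁻¹) hγ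
  have h0 : (fun i => ((v i)⁻¹ - (0 : ℂ) * w i)⁻¹) = v := by
    funext i
    simp
  simp only [h0] at hd
  have hne : ∀ i, ∀ᶠ t : ℂ in nhds 0, (v i)⁻¹ - t * w i ≠ 0 := fun i => by
    refine ContinuousAt.eventually_ne (by fun_prop) ?_
    simpa using hv.1 i
  have hz : (fun t : ℂ => MvPolynomial.eval (fun i => ((v i)⁻¹ - t * w i)⁻¹) f) =ᶠ[nhds 0]
      fun _ => 0 := by
    filter_upwards [Filter.eventually_all.mpr hne] with t ht
    refine hf _ ⟨fun i => inv_ne_zero (ht i), ?_⟩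
    convert W.sub_mem hv.2 (W.smul_mem t hw) using 1
    funext i
    simp
  exact hd.unique ((hasDerivAt_const (0 : ℂ) (0 : ℂ)).congr_of_eventuallyEq hz)

/-- The equation `∑ y_i / x_i = 0` with denominators cleared. -/
def reciprocalEquation (y : Fin (n + 1) → ℂ) : MvPolynomial (Fin (n + 1)) ℂ :=
  ∑ i, MvPolynomial.C (y i) * ∏ j ∈ Finset.univ.erase i, MvPolynomial.X j

theorem prod_erase_eq {v : Fin (n + 1) → ℂ} (hv : ∀ i, v i ≠ 0) (i : Fin (n + 1)) :
    ∏ j ∈ Finset.univ.erase i, v j = (∏ j, v j) * (v i)⁻¹ := by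
  rw [← Finset.mul_prod_erase Finset.univ v (Finset.mem_univ i)]
  field_simp [hv i]

theorem reciprocalEquation_mem {W : Submodule ℂ (Fin (n + 1) → ℂ)} {y : Fin (n + 1) → ℂ}
    (hy : y ∈ perp W) : reciprocalEquation y ∈
      homogeneousVanishing (varietyPower (linearSpace W) (-1)) := by
  refine mem_homogeneousVanishing_reciprocal.mpr ⟨⟨n, ?_⟩, fun v hv => ?_⟩
  · refine MvPolynomial.IsHomogeneous.sum _ _ _ fun i _ => ?_
    have h := MvPolynomial.IsHomogeneous.prod (Finset.univ.erase i)
      (fun j => (MvPolynomial.X j : MvPolynomial (Fin (n + 1)) ℂ)) (fun _ => 1)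
      fun j _ => MvPolynomial.isHomogeneous_X ℂ j
    have h' := (MvPolynomial.isHomogeneous_C (Fin (n + 1)) (y i)).mul h
    simpa using h'
  · simp only [reciprocalEquation, map_sum, map_mul, map_prod, MvPolynomial.eval_C,
      MvPolynomial.eval_X, prod_erase_eq hv.1]
    have := hy _ hv.2
    calc ∑ i, y i * ((∏ j, v j) * (v i)⁻¹) = (∏ j, v j) * ∑ i, v⁻¹ i * y i := by
          rw [Finset.mul_sum]
          exact Finset.sum_congr rfl fun i _ => by rw [Pi.inv_apply]; ring
      _ = 0 := by rw [this, mul_zero]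

/-- On the torus the equation is `D · ∑ yᵢ / xᵢ` with `D = ∏ xⱼ`. The sum vanishes at `v`, so only
the derivative of `yₖ / xₖ` survives. -/
theorem eval_pderiv_reciprocalEquation {W : Submodule ℂ (Fin (n + 1) → ℂ)}
    {y v : Fin (n + 1) → ℂ} (hy : y ∈ perp W) (hv : v ∈ reciprocalCone W) (k : Fin (n + 1)) :
    MvPolynomial.eval v (MvPolynomial.pderiv k (reciprocalEquation y)) =
      -(∏ j, v j) * ((v k ^ 2)⁻¹ * y k) := by
  let D : MvPolynomial (Fin (n + 1)) ℂ := ∏ j, MvPolynomial.X j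
  let Q : Fin (n + 1) → MvPolynomial (Fin (n + 1)) ℂ := fun i =>
    ∏ j ∈ Finset.univ.erase i, MvPolynomial.X j
  -- Differentiate `D = Xᵢ Qᵢ` and solve for the derivative of `Qᵢ`, which keeps the computation
  -- polynomial.
  have hD : ∀ i, MvPolynomial.eval v (MvPolynomial.pderiv k (Q i)) =
      (v i)⁻¹ * (MvPolynomial.eval v (MvPolynomial.pderiv k D) -
        if i = k then (∏ j, v j) * (v i)⁻¹ else 0) := fun i => by
    have h1 : D = MvPolynomial.X i * Q i :=
      (Finset.mul_prod_erase Finset.univ _ (Finset.mem_univ i)).symm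
    have h2 : MvPolynomial.eval v (Q i) = (∏ j, v j) * (v i)⁻¹ := by
      rw [← prod_erase_eq hv.1]
      simp [Q, map_prod]
    rw [h1, Derivation.leibniz, MvPolynomial.pderiv_X, Pi.single_apply]
    have := hv.1 i
    split_ifs with hik
    · simp only [smul_eq_mul, map_add, map_mul, MvPolynomial.eval_X, h2, map_one]
      field_simp
      ring
    · simp only [smul_eq_mul, map_add, map_mul, MvPolynomial.eval_X, map_zero]
      field_simp
      ring
  have hy' : ∑ i, y i * (v i)⁻¹ = 0 := by
    rw [← hy _ hv.2]
    exact Finset.sum_congr rfl fun i _ => mul_comm _ _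
  have hE : MvPolynomial.eval v (MvPolynomial.pderiv k (reciprocalEquation y)) =
      ∑ i, y i * MvPolynomial.eval v (MvPolynomial.pderiv k (Q i)) := by
    simp [reciprocalEquation, map_sum, Q]
  rw [hE]
  simp only [hD, mul_sub, Finset.sum_sub_distrib, ← mul_assoc, ← Finset.sum_mul, hy', zero_mul,
    mul_ite, mul_zero, Finset.sum_ite_eq', Finset.mem_univ, if_true]
  have := hv.1 k
  field_simp
  ring

/-- The gradients of the cleared equations at `v = p.rep` are nonzero multiples of `v⁻² z` with `z ∈
W^⊥`, so a tangent `y` has `v⁻² y ∈ W^⊥⊥ = W`. The converse is the curve computation. -/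
theorem mem_tangentSpace_reciprocal {W : Submodule ℂ (Fin (n + 1) → ℂ)} {p : PSpace n}
    (hp : p.rep ∈ reciprocalCone W) {y : Fin (n + 1) → ℂ} :
    y ∈ tangentSpace (varietyPower (linearSpace W) (-1)) p ↔ (p.rep ^ 2)⁻¹ * y ∈ W := by
  refine ⟨fun h => ?_, fun h f hf => ?_⟩
  · rw [← perp_perp W]
    intro z hz
    have h1 := h _ (reciprocalEquation_mem hz)
    simp only [eval_pderiv_reciprocalEquation hz hp, mul_assoc, ← Finset.mul_sum] at h1
    have h2 : (∏ j, p.rep j) ≠ 0 := Finset.prod_ne_zero_iff.mpr fun j _ => hp.1 j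
    have h3 := (mul_eq_zero.mp h1).resolve_left (neg_ne_zero.mpr h2)
    rw [← h3]
    refine Finset.sum_congr rfl fun i _ => ?_
    simp only [Pi.mul_apply, Pi.inv_apply, Pi.pow_apply]
    ring
  · rw [← sum_eval_pderiv_mul_sq_eq_zero (mem_homogeneousVanishing_reciprocal.mp hf).2 hp h]
    refine Finset.sum_congr rfl fun i _ => ?_
    have := hp.1 i
    simp only [Pi.mul_apply, Pi.inv_apply, Pi.pow_apply]
    field_simp

theorem finrank_tangentSpace_reciprocal {W : Submodule ℂ (Fin (n + 1) → ℂ)} {p : PSpace n}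
    (hp : p.rep ∈ reciprocalCone W) :
    Module.finrank ℂ (tangentSpace (varietyPower (linearSpace W) (-1)) p) =
      Module.finrank ℂ W := by
  have hinj : Function.Injective (LinearMap.mulLeft ℂ (p.rep ^ 2)) := fun a b hab => by
    funext i
    have := congrFun hab i
    exact mul_left_cancel₀ (pow_ne_zero 2 (hp.1 i)) this
  rw [(Submodule.equivMapOfInjective _ hinj W).finrank_eq]
  suffices h : tangentSpace (varietyPower (linearSpace W) (-1)) p =
      W.map (LinearMap.mulLeft ℂ (p.rep ^ 2)) by rw [h]
  ext y
  rw [mem_tangentSpace_reciprocal hp, Submodule.mem_map]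
  constructor
  · intro h
    refine ⟨_, h, ?_⟩
    funext i
    have := hp.1 i
    simp only [LinearMap.mulLeft_apply, Pi.mul_apply, Pi.inv_apply, Pi.pow_apply]
    field_simp
  · rintro ⟨w, hw, rfl⟩
    convert hw
    funext i
    have := hp.1 i
    simp only [LinearMap.mulLeft_apply, Pi.mul_apply, Pi.inv_apply, Pi.pow_apply]
    field_simp

/-! ### The dimension of the reciprocal linear space -/

section Parametrization

variable {m : ℕ} (P : (Fin m → ℂ) →ₗ[ℂ] (Fin (n + 1) → ℂ))

/-- The `i`-th coordinate of a linear parametrization, as a linear form in the parameters. -/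
def coordForm (i : Fin (n + 1)) : MvPolynomial (Fin m) ℂ :=
  ∑ j, MvPolynomial.C (P (Pi.single j 1) i) * MvPolynomial.X j

theorem eval_coordForm (t : Fin m → ℂ) (i : Fin (n + 1)) :
    MvPolynomial.eval t (coordForm P i) = P t i := by
  conv_rhs => rw [pi_eq_sum_univ' t]
  simp [coordForm, map_sum, mul_comm]

variable {P}

theorem coordForm_ne_zero {W : Submodule ℂ (Fin (n + 1) → ℂ)} (hP : LinearMap.range P = W)
    (hloop : ∀ i, ∃ x ∈ W, x i ≠ 0) (i : Fin (n + 1)) : coordForm P i ≠ 0 := by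
  obtain ⟨x, hx, hxi⟩ := hloop i
  rw [← hP] at hx
  obtain ⟨t, rfl⟩ := hx
  intro h
  rw [← eval_coordForm, h, map_zero] at hxi
  exact hxi rfl

/-- A polynomial in the parameters that vanishes wherever the parametrized point lies in the torus
is zero. -/
theorem eq_zero_of_eval_eq_zero_on_torus (hne : ∀ i, coordForm P i ≠ 0)
    {g : MvPolynomial (Fin m) ℂ}
    (hg : ∀ t, (∀ i, P t i ≠ 0) → MvPolynomial.eval t g = 0) : g = 0 := by
  -- The product of the coordinate forms vanishes exactly off the torus, so it kills the
  -- uncontrolled values of `g`; the polynomial ring is a domain.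
  have h : (∏ i, coordForm P i) * g = 0 := by
    refine MvPolynomial.funext fun t => ?_
    rw [map_mul, map_zero, map_prod]
    by_cases ht : ∀ i, P t i ≠ 0
    · rw [hg t ht, mul_zero]
    · push Not at ht
      obtain ⟨i, hi⟩ := ht
      rw [Finset.prod_eq_zero (Finset.mem_univ i) (by rw [eval_coordForm, hi]), zero_mul]
  exact (mul_eq_zero.mp h).resolve_left (Finset.prod_ne_zero_iff.mpr fun i _ => hne i)

theorem exists_mem_torus {W : Submodule ℂ (Fin (n + 1) → ℂ)} (hP : LinearMap.range P = W)
    (hne : ∀ i, coordForm P i ≠ 0) : ∃ w ∈ W, ∀ i, w i ≠ 0 := by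
  by_contra! h
  have : (1 : MvPolynomial (Fin m) ℂ) = 0 := eq_zero_of_eval_eq_zero_on_torus hne fun t ht => by
    obtain ⟨i, hi⟩ := h (P t) (hP ▸ LinearMap.mem_range_self P t)
    exact absurd hi (ht i)
  exact one_ne_zero this

variable (P) in
/-- The parametrization of the cone over the reciprocal linear space that one gets from
`t ↦ (P t)⁻¹` by clearing denominators. -/
def reciprocalHom : MvPolynomial (Fin (n + 1)) ℂ →ₐ[ℂ] MvPolynomial (Fin m) ℂ :=
  MvPolynomial.aeval fun i => ∏ j ∈ Finset.univ.erase i, coordForm P j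

theorem eval_reciprocalHom (t : Fin m → ℂ) (f : MvPolynomial (Fin (n + 1)) ℂ) :
    MvPolynomial.eval t (reciprocalHom P f) =
      MvPolynomial.eval (fun i => ∏ j ∈ Finset.univ.erase i, P t j) f := by
  rw [reciprocalHom, MvPolynomial.aeval_def, MvPolynomial.eval_eval₂]
  simp only [map_prod, eval_coordForm]
  rw [MvPolynomial.algebraMap_eq, MvPolynomial.eval, MvPolynomial.eval₂Hom_comp_C]
  rfl

theorem eval_eq_zero_of_reciprocalHom_eq_zero {W : Submodule ℂ (Fin (n + 1) → ℂ)}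
    (hn : n ≠ 0) (hP : LinearMap.range P = W) {f : MvPolynomial (Fin (n + 1)) ℂ}
    (hf : reciprocalHom P f = 0) {v : Fin (n + 1) → ℂ} (hv : v ∈ reciprocalCone W) :
    MvPolynomial.eval v f = 0 := by
  obtain ⟨hv0, hvW⟩ := hv
  rw [← hP] at hvW
  obtain ⟨t, ht⟩ := hvW
  -- The cleared parametrization is homogeneous of degree `n` and sends `t` to `(∏ vⱼ)⁻¹ v`.
  -- Rescaling `t` by an `n`-th root of `∏ vⱼ` hits `v` itself; this needs `n ≠ 0`.
  obtain ⟨s, hs⟩ := IsAlgClosed.exists_pow_nat_eq (∏ j, v j) (Nat.pos_of_ne_zero hn)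
  have h := eval_reciprocalHom (P := P) (s • t) f
  rw [hf, map_zero] at h
  rw [h]
  congr 2
  funext i
  have hi : ∏ j ∈ Finset.univ.erase i, v⁻¹ j = (∏ j, v j)⁻¹ * v i := by
    rw [prod_erase_eq (v := v⁻¹) (fun j => inv_ne_zero (hv0 j))]
    simp
  have hp : (∏ j, v j) ≠ 0 := Finset.prod_ne_zero_iff.mpr fun j _ => hv0 j
  simp only [map_smul, ht, Pi.smul_apply, smul_eq_mul, Finset.prod_mul_distrib, hi,
    Finset.prod_const, Finset.card_erase_of_mem (Finset.mem_univ i), Finset.card_univ,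
    Fintype.card_fin, Nat.add_sub_cancel, hs]
  field_simp

theorem reciprocalHom_eq_zero {W : Submodule ℂ (Fin (n + 1) → ℂ)}
    (hP : LinearMap.range P = W) (hne : ∀ i, coordForm P i ≠ 0)
    {f : MvPolynomial (Fin (n + 1)) ℂ}
    (hf : ∀ v ∈ reciprocalCone W, MvPolynomial.eval v f = 0) : reciprocalHom P f = 0 := by
  refine eq_zero_of_eval_eq_zero_on_torus hne fun t ht => ?_
  rw [eval_reciprocalHom]
  refine hf _ ?_
  have : (fun i => ∏ j ∈ Finset.univ.erase i, P t j) = (∏ j, P t j) • (P t)⁻¹ := by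
    funext i
    rw [prod_erase_eq ht]
    rfl
  rw [this]
  exact smul_mem_reciprocalCone (inv_mem_reciprocalCone (hP ▸ LinearMap.mem_range_self P t) ht)
    (Finset.prod_ne_zero_iff.mpr fun j _ => ht j)

theorem vanishingIdeal_reciprocal {W : Submodule ℂ (Fin (n + 1) → ℂ)} (hn : n ≠ 0)
    (hP : LinearMap.range P = W) (hne : ∀ i, coordForm P i ≠ 0) :
    vanishingIdeal (varietyPower (linearSpace W) (-1)) = RingHom.ker (reciprocalHom P) := by
  refine le_antisymm (Ideal.span_le.mpr fun f hf => ?_) fun f hf => ?_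
  · exact reciprocalHom_eq_zero hP hne (mem_homogeneousVanishing_reciprocal.mp hf).2
  · rw [← MvPolynomial.sum_homogeneousComponent f]
    exact Ideal.sum_mem _ fun k _ => Ideal.subset_span
      (homogeneousComponent_mem_homogeneousVanishing
        (fun v hv => eval_eq_zero_of_reciprocalHom_eq_zero hn hP hf hv) k)

/-- Write `ℓᵢ` for the coordinate forms, `D` for their product and `ψᵢ = D / ℓᵢ`. Then `∏ ψⱼ = D ^ n
= (ψᵢ ℓᵢ) ^ n`, so `ℓᵢ` is a root of `ψᵢ ^ n X ^ n - ∏ ψⱼ`. As `P` is injective, the `ℓᵢ` span all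
linear forms and generate the polynomial ring. -/
theorem isAlgebraic_range_reciprocalHom (hn : n ≠ 0) (hinj : Function.Injective P)
    (hne : ∀ i, coordForm P i ≠ 0) :
    Algebra.IsAlgebraic (reciprocalHom P).range (MvPolynomial (Fin m) ℂ) := by
  let S := (reciprocalHom P).range
  let ψ : Fin (n + 1) → S := fun i => ⟨reciprocalHom P (MvPolynomial.X i), _, rfl⟩
  have hψ : ∀ i, (ψ i : MvPolynomial (Fin m) ℂ) = ∏ j ∈ Finset.univ.erase i, coordForm P j :=
    fun i => by simp [ψ, reciprocalHom]
  have hψ0 : ∀ i, ψ i ≠ 0 := fun i h => by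
    have := congrArg Subtype.val h
    rw [hψ] at this
    exact Finset.prod_ne_zero_iff.mpr (fun j _ => hne j) this
  have hmul : ∀ i, (ψ i : MvPolynomial (Fin m) ℂ) * coordForm P i = ∏ j, coordForm P j :=
    fun i => by rw [hψ, mul_comm, Finset.mul_prod_erase _ _ (Finset.mem_univ i)]
  have hform : ∀ i, IsAlgebraic S (coordForm P i) := fun i => by
    refine ⟨Polynomial.C (ψ i ^ n) * Polynomial.X ^ n - Polynomial.C (∏ j, ψ j), fun h => ?_, ?_⟩
    · have := congrArg (fun p => Polynomial.coeff p n) h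
      rw [Polynomial.coeff_sub, Polynomial.coeff_C_mul_X_pow, Polynomial.coeff_C, if_pos rfl,
        if_neg hn, sub_zero, Polynomial.coeff_zero] at this
      exact pow_ne_zero n (hψ0 i) this
    · have hprod : (∏ j, (ψ j : MvPolynomial (Fin m) ℂ)) = (∏ j, coordForm P j) ^ n := by
        have hD : (∏ j, coordForm P j) ≠ 0 := Finset.prod_ne_zero_iff.mpr fun j _ => hne j
        refine mul_right_cancel₀ hD ?_
        rw [← pow_succ, ← Finset.prod_mul_distrib, Finset.prod_congr rfl fun j _ => hmul j]
        simp
      have hcoe : ∀ a : S, algebraMap S (MvPolynomial (Fin m) ℂ) a = a := fun _ => rfl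
      simp only [map_sub, map_mul, map_pow, Polynomial.aeval_C, Polynomial.aeval_X, map_prod,
        hcoe, hprod]
      rw [← mul_pow, hmul, sub_self]
  obtain ⟨G, hG⟩ := LinearMap.exists_leftInverse_of_injective P (LinearMap.ker_eq_bot.mpr hinj)
  have hX : ∀ k, (MvPolynomial.X k : MvPolynomial (Fin m) ℂ) =
      ∑ i, MvPolynomial.C (G (Pi.single i 1) k) * coordForm P i := fun k => by
    refine MvPolynomial.funext fun t => ?_
    have h1 : G (P t) = t := LinearMap.congr_fun hG t
    conv_lhs => rw [MvPolynomial.eval_X, ← h1, pi_eq_sum_univ' (P t)]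
    simp [map_sum, eval_coordForm, mul_comm]
  have hC : ∀ c : ℂ, IsAlgebraic S (MvPolynomial.C c : MvPolynomial (Fin m) ℂ) := fun c =>
    isAlgebraic_algebraMap (algebraMap ℂ S c)
  have hXalg : ∀ k, IsAlgebraic S (MvPolynomial.X k : MvPolynomial (Fin m) ℂ) := fun k => by
    rw [hX]
    exact Finset.sum_induction _ (IsAlgebraic S) (fun _ _ => IsAlgebraic.add) isAlgebraic_zero
      fun i _ => (hC _).mul (hform i)
  refine ⟨fun f => ?_⟩
  induction f using MvPolynomial.induction_on with
  | C a => exact hC a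
  | add p q hp hq => exact hp.add hq
  | mul_X p i hp => exact hp.mul (hXalg i)

/-- The coordinate ring is isomorphic to the range of `reciprocalHom`, over which the polynomial
ring in `m` variables is algebraic. -/
theorem trdeg_coordinateRing_reciprocal {W : Submodule ℂ (Fin (n + 1) → ℂ)} (hn : n ≠ 0)
    (hP : LinearMap.range P = W) (hinj : Function.Injective P) (hne : ∀ i, coordForm P i ≠ 0) :
    Algebra.trdeg ℂ (CoordinateRing (varietyPower (linearSpace W) (-1))) = m := by
  have e : CoordinateRing (varietyPower (linearSpace W) (-1)) ≃ₐ[ℂ] (reciprocalHom P).range :=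
    (Ideal.quotientEquivAlgOfEq ℂ (vanishingIdeal_reciprocal hn hP hne)).trans
      (Ideal.quotientKerEquivRange (reciprocalHom P))
  have := isAlgebraic_range_reciprocalHom hn hinj hne
  have hfaith : FaithfulSMul ℂ (reciprocalHom P).range :=
    (faithfulSMul_iff_algebraMap_injective _ _).mpr (algebraMap ℂ (reciprocalHom P).range).injective
  have h := trdeg_add_eq ℂ (reciprocalHom P).range (A := MvPolynomial (Fin m) ℂ)
  rw [trdeg_eq_zero (R := (reciprocalHom P).range), add_zero, MvPolynomial.trdeg_of_isDomain] at h
  rw [e.trdeg_eq, h]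
  simp

end Parametrization

theorem exists_parametrization {d : ℕ} (W : Submodule ℂ (Fin (n + 1) → ℂ))
    (hW : Module.finrank ℂ W = d) : ∃ P : (Fin d → ℂ) →ₗ[ℂ] (Fin (n + 1) → ℂ),
      Function.Injective P ∧ LinearMap.range P = W := by
  let b := Module.finBasisOfFinrankEq ℂ W hW
  refine ⟨W.subtype ∘ₗ b.equivFun.symm.toLinearMap,
    W.injective_subtype.comp b.equivFun.symm.injective, ?_⟩
  rw [LinearMap.range_comp, LinearEquiv.range, Submodule.map_top, Submodule.range_subtype]

/-! ### The set of products `x² y`: Hadamard product and uniformization -/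

theorem eval_bind₁ {σ τ : Type*} (g : σ → MvPolynomial τ ℂ) (f : MvPolynomial σ ℂ) (v : τ → ℂ) :
    MvPolynomial.eval v (MvPolynomial.bind₁ g f) =
      MvPolynomial.eval (fun i => MvPolynomial.eval v (g i)) f := by
  rw [← MvPolynomial.coe_aeval_eq_eval, ← MvPolynomial.coe_aeval_eq_eval]
  exact MvPolynomial.aeval_bind₁ _ _ _

/-- The points `x² y` with `x ∈ W` and `y ∈ W^⊥`. -/
def squareMulPerp (W : Submodule ℂ (Fin (n + 1) → ℂ)) : Set (PSpace n) :=
  {z | ∃ x ∈ W, ∃ y ∈ perp W, ∃ h : x ^ 2 * y ≠ 0, z = Projectivization.mk ℂ (x ^ 2 * y) h}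

theorem mem_homogeneousVanishing_squareMulPerp {W : Submodule ℂ (Fin (n + 1) → ℂ)}
    {f : MvPolynomial (Fin (n + 1)) ℂ} :
    f ∈ homogeneousVanishing (squareMulPerp W) ↔ (∃ k : ℕ, f.IsHomogeneous k) ∧
      ∀ x ∈ W, ∀ y ∈ perp W, x ^ 2 * y ≠ 0 → MvPolynomial.eval (x ^ 2 * y) f = 0 := by
  refine and_congr_right fun ⟨k, hf⟩ => ⟨fun h x hx y hy hxy => ?_, ?_⟩
  · exact (eval_rep_eq_zero_iff hf _ hxy).mp (h _ ⟨x, hx, y, hy, hxy, rfl⟩)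
  · rintro h _ ⟨x, hx, y, hy, hxy, rfl⟩
    exact (eval_rep_eq_zero_iff hf _ hxy).mpr (h x hx y hy hxy)

theorem mk_smul_eq {v w : Fin (n + 1) → ℂ} (hv : v ≠ 0) (hw : w ≠ 0) (a : ℂ) (h : a • w = v) :
    Projectivization.mk ℂ v hv = Projectivization.mk ℂ w hw :=
  (Projectivization.mk_eq_mk_iff' ℂ _ _ _ _).mpr ⟨a, h⟩

theorem ne_zero_of_smul_eq {v w : Fin (n + 1) → ℂ} (hv : v ≠ 0) {a : ℂ} (h : a • w = v) :
    w ≠ 0 := by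
  rintro rfl
  exact hv (by rw [← h, smul_zero])

theorem hadamardProduct_eq (W : Submodule ℂ (Fin (n + 1) → ℂ)) :
    hadamardProduct (varietyPower (linearSpace W) 2) (linearSpace (perp W)) =
      zariskiClosure (squareMulPerp W) := by
  rw [hadamardProduct, varietyPower, if_pos (by norm_num)]
  congr 1
  ext z
  constructor
  · rintro ⟨_, ⟨p, hp, rfl⟩, q, hq, h, rfl⟩
    obtain ⟨a, ha⟩ := Projectivization.exists_smul_eq_mk_rep ℂ (fun i => p.rep i ^ (2 : ℤ))
      (zpow_coords_ne_zero 2 p.rep_nonzero)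
    have h1 : (a : ℂ) • (p.rep ^ 2 * q.rep) = fun i => (powerMap 2 p).rep i * q.rep i := by
      funext i
      rw [powerMap, ← ha]
      simp [Units.smul_def, mul_assoc, zpow_ofNat]
    exact ⟨p.rep, hp, q.rep, hq, ne_zero_of_smul_eq h h1, mk_smul_eq _ _ _ h1⟩
  · rintro ⟨x, hx, y, hy, h, rfl⟩
    have hx0 : x ≠ 0 := by
      rintro rfl
      exact h (by simp)
    have hy0 : y ≠ 0 := by
      rintro rfl
      exact h (by simp)
    obtain ⟨a, ha⟩ := Projectivization.exists_smul_eq_mk_rep ℂ (fun i => x i ^ (2 : ℤ))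
      (zpow_coords_ne_zero 2 hx0)
    obtain ⟨b, hb⟩ := Projectivization.exists_smul_eq_mk_rep ℂ y hy0
    -- The scalars undo the choice of representatives.
    have h1 : ((a : ℂ)⁻¹ * (b : ℂ)⁻¹) • (fun i => (powerMap 2 (Projectivization.mk ℂ x hx0)).rep i *
        (Projectivization.mk ℂ y hy0).rep i) = x ^ 2 * y := by
      funext i
      rw [powerMap_mk, ← ha, ← hb]
      have := a.ne_zero
      have := b.ne_zero
      simp [Units.smul_def, zpow_ofNat]
      field_simp
    exact ⟨_, ⟨_, mk_mem_linearSpace hx0 hx, rfl⟩, _, mk_mem_linearSpace hy0 hy,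
      ne_zero_of_smul_eq h h1, mk_smul_eq _ _ _ h1⟩

theorem uniformizationImage_eq {d m : ℕ} {W : Submodule ℂ (Fin (n + 1) → ℂ)}
    {A : Matrix (Fin (d + 1)) (Fin (n + 1)) ℂ} {B : Matrix (Fin (n + 1)) (Fin m) ℂ}
    (hA : Submodule.span ℂ (Set.range fun j i => A j i) = W)
    (hB : Submodule.span ℂ (Set.range fun (k : Fin m) (i : Fin (n + 1)) => B i k) = perp W) :
    uniformizationImage A B = squareMulPerp W := by
  have hAt : ∀ t : Fin (d + 1) → ℂ, (fun i => ∑ j, t j * A j i) = ∑ j, t j • A j := fun t => by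
    funext i
    simp
  have hBu : ∀ u : Fin m → ℂ, (fun i => ∑ k, B i k * u k) = ∑ k, u k • fun i => B i k :=
    fun u => by
      funext i
      simp [mul_comm]
  ext z
  constructor
  · rintro ⟨t, u, h, rfl⟩
    refine ⟨fun i => ∑ j, t.rep j * A j i, ?_, fun i => ∑ k, B i k * u.rep k, ?_, h, rfl⟩
    · rw [hAt, ← hA]
      exact Submodule.sum_mem _ fun j _ => Submodule.smul_mem _ _
        (Submodule.subset_span ⟨j, rfl⟩)
    · rw [hBu, ← hB]
      exact Submodule.sum_mem _ fun j _ => Submodule.smul_mem _ _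
        (Submodule.subset_span ⟨j, rfl⟩)
  · rintro ⟨x, hx, y, hy, h, rfl⟩
    rw [← hA] at hx
    rw [← hB] at hy
    obtain ⟨t, rfl⟩ := (Submodule.mem_span_range_iff_exists_fun ℂ).mp hx
    obtain ⟨u, rfl⟩ := (Submodule.mem_span_range_iff_exists_fun ℂ).mp hy
    -- The parameters must define projective points; a zero parameter would make `x² y` zero.
    have ht0 : t ≠ 0 := by
      rintro rfl
      exact h (by simp)
    have hu0 : u ≠ 0 := by
      rintro rfl
      exact h (by simp)
    obtain ⟨a, ha⟩ := Projectivization.exists_smul_eq_mk_rep ℂ t ht0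
    obtain ⟨b, hb⟩ := Projectivization.exists_smul_eq_mk_rep ℂ u hu0
    have h1 : (((a : ℂ) ^ 2)⁻¹ * (b : ℂ)⁻¹) • (fun i =>
        (∑ j, (Projectivization.mk ℂ t ht0).rep j * A j i) ^ 2 *
          ∑ k, B i k * (Projectivization.mk ℂ u hu0).rep k) =
        (∑ j, t j • fun i => A j i) ^ 2 * ∑ k, u k • fun i => B i k := by
      funext i
      have h2 : ∑ j, (Projectivization.mk ℂ t ht0).rep j * A j i = a * ∑ j, t j * A j i := by
        rw [← ha, Finset.mul_sum]
        simp [Units.smul_def, mul_assoc]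
      have h3 : ∑ k, B i k * (Projectivization.mk ℂ u hu0).rep k = b * ∑ k, u k * B i k := by
        rw [← hb, Finset.mul_sum]
        refine Finset.sum_congr rfl fun k _ => ?_
        simp only [Units.smul_def, Pi.smul_apply, smul_eq_mul]
        ring
      have := a.ne_zero
      have := b.ne_zero
      simp only [Pi.smul_apply, h2, h3, smul_eq_mul, Pi.mul_apply, Pi.pow_apply, Finset.sum_apply]
      field_simp
    exact ⟨_, _, ne_zero_of_smul_eq h h1, mk_smul_eq _ _ _ h1⟩

/-! ### Conormal vectors on and off the torus -/

/-- A vector that pairs to zero with the tangent space is the value at the point of a polynomial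
vector field that pairs to zero with the tangent space at every torus point. -/
theorem exists_polynomial_conormal {W : Submodule ℂ (Fin (n + 1) → ℂ)} {p : PSpace n}
    {z : Fin (n + 1) → ℂ}
    (hz : ∀ y ∈ tangentSpace (varietyPower (linearSpace W) (-1)) p, ∑ i, z i * y i = 0) :
    ∃ g : Fin (n + 1) → MvPolynomial (Fin (n + 1)) ℂ,
      (fun j => MvPolynomial.eval p.rep (g j)) = z ∧
      ∀ v ∈ reciprocalCone W, ∀ w ∈ W, ∑ j, MvPolynomial.eval v (g j) * (v j ^ 2 * w j) = 0 := by
  let X := varietyPower (linearSpace W) (-1)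
  let U : Submodule ℂ (Fin (n + 1) → ℂ) := Submodule.span ℂ
    ((fun f j => MvPolynomial.eval p.rep (MvPolynomial.pderiv j f)) '' homogeneousVanishing X)
  -- The tangent space is the orthogonal complement of the span `U` of the gradients, so `z ∈ U^⊥⊥ =
  -- U`. A combination of gradients at `p` extends to the same combination of gradient fields.
  have hzU : z ∈ U := by
    rw [← perp_perp U]
    intro y hy
    rw [← hz y fun f hf => hy _ (Submodule.subset_span ⟨f, hf, rfl⟩)]
    exact Finset.sum_congr rfl fun i _ => mul_comm _ _
  clear hz
  induction hzU using Submodule.span_induction with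
  | mem z hz =>
    obtain ⟨f, hf, rfl⟩ := hz
    exact ⟨fun j => MvPolynomial.pderiv j f, rfl, fun v hv w hw =>
      sum_eval_pderiv_mul_sq_eq_zero (mem_homogeneousVanishing_reciprocal.mp hf).2 hv hw⟩
  | zero => exact ⟨0, by funext j; simp, by simp⟩
  | add z₁ z₂ _ _ h₁ h₂ =>
    obtain ⟨g₁, rfl, h₁⟩ := h₁
    obtain ⟨g₂, rfl, h₂⟩ := h₂
    refine ⟨g₁ + g₂, by funext j; simp, fun v hv w hw => ?_⟩
    simp only [Pi.add_apply, map_add, add_mul, Finset.sum_add_distrib, h₁ v hv w hw, h₂ v hv w hw,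
      add_zero]
  | smul c z _ h =>
    obtain ⟨g, rfl, h⟩ := h
    refine ⟨fun j => MvPolynomial.C c * g j, by funext j; simp, fun v hv w hw => ?_⟩
    simp only [map_mul, MvPolynomial.eval_C, mul_assoc, ← Finset.mul_sum, h v hv w hw, mul_zero]

theorem mk_mem_conormal {W : Submodule ℂ (Fin (n + 1) → ℂ)} {p : PSpace n}
    (hp : p.rep ∈ reciprocalCone W)
    (htr : Algebra.trdeg ℂ (CoordinateRing (varietyPower (linearSpace W) (-1))) =
      Module.finrank ℂ W) {y : Fin (n + 1) → ℂ} (hy : y ∈ perp W) (h : (p.rep ^ 2)⁻¹ * y ≠ 0) :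
    (p, Projectivization.mk ℂ _ h) ∈ conormal (varietyPower (linearSpace W) (-1)) := by
  refine ⟨⟨?_, ?_⟩, fun t ht => ?_⟩
  · have := mk_mem_reciprocal hp p.rep_nonzero
    rwa [Projectivization.mk_rep] at this
  · rw [finrank_tangentSpace_reciprocal hp, htr]
  · have h1 := hy _ ((mem_tangentSpace_reciprocal hp).mp ht)
    obtain ⟨a, ha⟩ := Projectivization.exists_smul_eq_mk_rep ℂ _ h
    simp only
    rw [← ha, ← mul_zero (a : ℂ), ← h1, Finset.mul_sum]
    refine Finset.sum_congr rfl fun i _ => ?_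
    simp only [Units.smul_def, Pi.smul_apply, smul_eq_mul, Pi.mul_apply, Pi.inv_apply, Pi.pow_apply]
    ring

theorem exists_ne_zero_mem_perp {W : Submodule ℂ (Fin (n + 1) → ℂ)}
    (hW : Module.finrank ℂ W < n + 1) : ∃ y ∈ perp W, y ≠ 0 := by
  by_contra! h
  have h1 : W = ⊤ := by
    rw [← perp_perp W, eq_top_iff]
    intro x _ y hy
    simp [h y hy]
  rw [h1, finrank_top] at hW
  simp at hW

/-- The tangent space is known only on the torus, so `q.2` is extended to a polynomial field `g`. At
torus points `v` the value of `g` lies in `v⁻² W^⊥`, hence `f ∘ g` vanishes there, and so also at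
the point `q.1` of the closure. -/
theorem eval_eq_zero_of_mem_conormal {W : Submodule ℂ (Fin (n + 1) → ℂ)}
    (hW : Module.finrank ℂ W < n + 1) (htorus : ∃ w ∈ W, ∀ i, w i ≠ 0)
    {f : MvPolynomial (Fin (n + 1)) ℂ} (hf : f ∈ homogeneousVanishing (squareMulPerp W))
    {q : PSpace n × PSpace n} (hq : q ∈ conormal (varietyPower (linearSpace W) (-1))) :
    MvPolynomial.eval q.2.rep f = 0 := by
  obtain ⟨⟨k, hk⟩, hf⟩ := mem_homogeneousVanishing_squareMulPerp.mp hf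
  obtain ⟨g, hg, hgW⟩ := exists_polynomial_conormal hq.2
  -- The field `g` may vanish at some points, so `f(0) = 0` is needed as well. Writing `0` as `0`
  -- times a nonzero `w² u` at which `f` vanishes also covers constant `f`.
  have hall : ∀ x ∈ W, ∀ y ∈ perp W, MvPolynomial.eval (x ^ 2 * y) f = 0 := fun x hx y hy => by
    by_cases h : x ^ 2 * y = 0
    · obtain ⟨w, hw, hw0⟩ := htorus
      obtain ⟨u, hu, hu0⟩ := exists_ne_zero_mem_perp hW
      have hne : w ^ 2 * u ≠ 0 := fun h0 => hu0 <| by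
        funext i
        exact (mul_eq_zero.mp (congrFun h0 i)).resolve_left (pow_ne_zero 2 (hw0 i))
      rw [h, ← zero_smul ℂ (w ^ 2 * u), eval_smul_of_isHomogeneous hk, hf w hw u hu hne, mul_zero]
    · exact hf x hx y hy h
  rw [← hg, ← eval_bind₁]
  refine eval_rep_eq_zero_of_mem_reciprocal (fun v hv => ?_) hq.1.1
  rw [eval_bind₁]
  have h1 : v ^ 2 * (fun j => MvPolynomial.eval v (g j)) ∈ perp W := fun w hw => by
    rw [← hgW v hv w hw]
    refine Finset.sum_congr rfl fun i _ => ?_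
    simp only [Pi.mul_apply, Pi.pow_apply]
    ring
  have h2 : (fun j => MvPolynomial.eval v (g j)) =
      v⁻¹ ^ 2 * (v ^ 2 * fun j => MvPolynomial.eval v (g j)) := by
    funext i
    have := hv.1 i
    simp only [Pi.mul_apply, Pi.pow_apply, Pi.inv_apply]
    field_simp
  rw [h2]
  exact hall _ hv.2 _ h1

theorem eval_eq_zero_of_torus {m : ℕ} {P : (Fin m → ℂ) →ₗ[ℂ] (Fin (n + 1) → ℂ)}
    (hne : ∀ i, coordForm P i ≠ 0) {f : MvPolynomial (Fin (n + 1)) ℂ} {y : Fin (n + 1) → ℂ}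
    (hf : ∀ t, (∀ i, P t i ≠ 0) → MvPolynomial.eval (P t ^ 2 * y) f = 0) (t : Fin m → ℂ) :
    MvPolynomial.eval (P t ^ 2 * y) f = 0 := by
  let g : MvPolynomial (Fin m) ℂ :=
    MvPolynomial.bind₁ (fun i => coordForm P i ^ 2 * MvPolynomial.C (y i)) f
  have hg : ∀ t, MvPolynomial.eval t g = MvPolynomial.eval (P t ^ 2 * y) f := fun t => by
    simp only [g, eval_bind₁, map_mul, map_pow, eval_coordForm, MvPolynomial.eval_C]
    rfl
  have : g = 0 := eq_zero_of_eval_eq_zero_on_torus hne fun t ht => by rw [hg, hf t ht]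
  rw [← hg, this, map_zero]

/-! ### Comparison of the two closures -/

theorem matroidDiscriminantVariety_eq {d : ℕ} (hd : d < n) (W : Submodule ℂ (Fin (n + 1) → ℂ))
    (hW : Module.finrank ℂ W = d + 1) (hloop : ∀ i, ∃ x ∈ W, x i ≠ 0) :
    matroidDiscriminantVariety (linearSpace W) = zariskiClosure (squareMulPerp W) := by
  obtain ⟨P, hinj, hP⟩ := exists_parametrization W hW
  have hne := coordForm_ne_zero hP hloop
  have htr : Algebra.trdeg ℂ (CoordinateRing (varietyPower (linearSpace W) (-1))) =
      Module.finrank ℂ W := by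
    rw [trdeg_coordinateRing_reciprocal (by omega) hP hinj hne, hW]
  refine zariskiClosure_eq_of_homogeneousVanishing_eq (Set.Subset.antisymm (fun f hf => ?_)
    fun f hf => ⟨hf.1, ?_⟩)
  · obtain ⟨⟨k, hk⟩, hf⟩ := hf
    refine mem_homogeneousVanishing_squareMulPerp.mpr ⟨⟨k, hk⟩, fun x hx y hy hxy => ?_⟩
    have hy0 : y ≠ 0 := by
      rintro rfl
      exact hxy (mul_zero _)
    rw [← hP] at hx
    obtain ⟨t, rfl⟩ := hx
    -- By density of the torus in `W`, with `y` fixed, it suffices to treat `x = P t` in the torus.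
    -- There `x² y` is, up to the square of a scalar, the conormal vector `v⁻² y` at the point with
    -- representative `v` proportional to `x⁻¹`.
    refine eval_eq_zero_of_torus hne (fun t ht => ?_) t
    have hv := inv_mem_reciprocalCone (hP ▸ LinearMap.mem_range_self P t) ht
    obtain ⟨a, ha⟩ := Projectivization.exists_smul_eq_mk_rep ℂ _ (ne_zero_of_forall_ne_zero hv.1)
    have hp := smul_mem_reciprocalCone hv a.ne_zero
    rw [← Units.smul_def, ha] at hp
    have h1 : ((a : ℂ) ^ 2)⁻¹ • (P t ^ 2 * y) = ((Projectivization.mk ℂ _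
        (ne_zero_of_forall_ne_zero hv.1)).rep ^ 2)⁻¹ * y := by
      rw [← ha]
      funext i
      simp only [Units.smul_def, Pi.smul_apply, smul_eq_mul, Pi.mul_apply, Pi.inv_apply,
        Pi.pow_apply, mul_pow, mul_inv, inv_pow, inv_inv]
      ring
    have h2 : ((Projectivization.mk ℂ _ (ne_zero_of_forall_ne_zero hv.1)).rep ^ 2)⁻¹ * y ≠ 0 :=
      fun h0 => hy0 <| by
        funext i
        exact (mul_eq_zero.mp (congrFun h0 i)).resolve_left
          (inv_ne_zero (pow_ne_zero 2 (hp.1 i)))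
    have h3 := hf _ ⟨_, mk_mem_conormal hp htr hy h2, rfl⟩
    rw [eval_rep_eq_zero_iff hk, ← h1, eval_smul_of_isHomogeneous hk] at h3
    exact (mul_eq_zero.mp h3).resolve_left
      (pow_ne_zero k (inv_ne_zero (pow_ne_zero 2 a.ne_zero)))
  · rintro _ ⟨q, hq, rfl⟩
    exact eval_eq_zero_of_mem_conormal (by omega) (exists_mem_torus hP hne) hf hq

theorem ker_mulVecLin_eq_perp {d : ℕ} {W : Submodule ℂ (Fin (n + 1) → ℂ)}
    {A : Matrix (Fin (d + 1)) (Fin (n + 1)) ℂ}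
    (hA : Submodule.span ℂ (Set.range fun j i => A j i) = W) :
    LinearMap.ker A.mulVecLin = perp W := by
  subst hA
  ext y
  rw [LinearMap.mem_ker, Matrix.mulVecLin_apply]
  refine ⟨fun h x hx => ?_, fun h => ?_⟩
  · obtain ⟨t, rfl⟩ := (Submodule.mem_span_range_iff_exists_fun ℂ).mp hx
    have h1 : ∀ j, ∑ i, A j i * y i = 0 := fun j => congrFun h j
    simp only [Finset.sum_apply, Pi.smul_apply, smul_eq_mul, Finset.sum_mul]
    rw [Finset.sum_comm]
    refine Finset.sum_eq_zero fun j _ => ?_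
    simp only [mul_assoc, ← Finset.mul_sum, h1, mul_zero]
  · funext j
    exact h _ (Submodule.subset_span ⟨j, rfl⟩)

end MatroidDiscriminant

end

theorem mainTheorem6 {n d : ℕ} (hd : d < n) (W : Submodule ℂ (Fin (n + 1) → ℂ))
    (hW : Module.finrank ℂ W = d + 1) (hloop : ∀ i, ∃ x ∈ W, x i ≠ 0) :
    MatroidDiscriminant.matroidDiscriminantVariety (MatroidDiscriminant.linearSpace W) =
      MatroidDiscriminant.hadamardProduct
        (MatroidDiscriminant.varietyPower (MatroidDiscriminant.linearSpace W) 2)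
        (MatroidDiscriminant.linearSpace (MatroidDiscriminant.perp W)) ∧
    ∀ (A : Matrix (Fin (d + 1)) (Fin (n + 1)) ℂ) (B : Matrix (Fin (n + 1)) (Fin (n - d)) ℂ),
      Submodule.span ℂ (Set.range fun j i => A j i) = W →
      LinearIndependent ℂ (fun (k : Fin (n - d)) (i : Fin (n + 1)) => B i k) →
      Submodule.span ℂ (Set.range fun (k : Fin (n - d)) (i : Fin (n + 1)) => B i k) =
        LinearMap.ker A.mulVecLin →
      MatroidDiscriminant.matroidDiscriminantVariety (MatroidDiscriminant.linearSpace W) =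
        MatroidDiscriminant.zariskiClosure (MatroidDiscriminant.uniformizationImage A B) := by
  rw [MatroidDiscriminant.matroidDiscriminantVariety_eq hd W hW hloop]
  refine ⟨(MatroidDiscriminant.hadamardProduct_eq W).symm, fun A B hA _ hB => ?_⟩
  rw [MatroidDiscriminant.ker_mulVecLin_eq_perp hA] at hB
  rw [MatroidDiscriminant.uniformizationImage_eq hA hB]
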